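/- **Setting.** Let $M\subseteq\mathbb R\times\mathbb R^n\times\mathbb R^m$ be a nonempty open set with coordinates $(t,x,u)$, let $f:M\to\mathbb R^n$ be smooth, and consider the control system $\dot x=f(t,x,u)$ on $M$, with Pfaffian system $\boldsymbol\omega=\mathrm{span}\{dx^i-f^i\,dt\}_{1\le i\le n}$. Its trajectories are the smooth curves $t\mapsto(t,x(t),u(t))\in M$ on open intervals with $\dot x=f(t,x,u)$. For a signature $\nu=\langle\rho_1,\dots,\rho_k\rangle$ of nonnegative integers take $\rho_j$ functions $z^a$ of order $r_a=j$ for each $1\le j\le k$. The partial jet space $J^\nu$ has coordinates $t$ and $z^a_\ell$, $0\le\ell\le r_a$, so $\dim J^\nu=1+\sum_{j=1}^k(1+j)\rho_j$, and carries the Brunovský normal form $\boldsymbol\beta^\nu=\mathrm{span}\{dz^a_\ell-z^a_{\ell+1}dt : 0\le\ell<r_a\}$. For a tuple $z=(z^a)$ of smooth functions, $j^\nu z(t)=(t,(z^a)^{(\ell)}(t))_{0\le\ell\le r_a}$. An *explicit solution of signature $\nu$* is a smooth map $\psi:W\to M$ of the form $(t,z)\mapsto(t,A(t,z),B(t,z))$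 on an open set $W\subseteq J^\nu$, where $\sum_j\rho_j=m$, such that 1. each $z^a$ occurs to order exactly $r_a$, that is, $\partial\psi/\partial z^a_{r_a}\not\equiv0$ on $W$; 2. for all smooth $z$ on an open interval with $j^\nu z$ in $W$, $\psi\circ j^\nu z$ is a trajectory; 3. all generic trajectories are locally of this form: for some $K\ge0$ there is an open $G\subseteq\mathbb R\times\mathbb R^n\times\mathbb R^m\times(\mathbb R^m)^K$ whose closure contains $M\times(\mathbb R^m)^K$ such that, if a trajectory satisfies $(t_0,x(t_0),u(t_0),u'(t_0),\dots,u^{(K)}(t_0))\in G$, then on an open interval containing $t_0$ it equals $\psi\circ j^\nu z$ for some smooth $z$ with $j^\nu z$ in $W$. A *static feedback linearization* of the system, of signature $\nu$ with $\sum_j\rho_j=m$, is a smooth local diffeomorphism $\varphi:W'\to M$ from an open set $W'\subseteq J^\nu$, with image dense in $M$ (that is, it reaches generic points of $M$), which preserves $t$, whose $x$-component locally depends only on $t$ and the $z^a_\ell$ with $\ell<r_a$ (not on the inputs $z^a_{r_a}$), and which satisfies $\varphi^*\boldsymbol\omega=\boldsymbol\beta^\nu$. The system is *static feedback linearizable*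 (SFL) if it has a static feedback linearization of some signature. **Proposition.** (i) Let $\psi:W\to M$ be an explicit solution of signature $\nu$ of the system. Then $\psi$ determines a static feedback linearization (that is, the restriction of $\psi$ to some open subset $W'\subseteq W$ is a static feedback linearization) if and only if $\dim M=\dim J^\nu$. (ii) Consequently, the system is SFL if and only if it admits an explicit solution whose signature $\nu$ satisfies $\dim M=\dim J^\nu$. -/

import Mathlib

open Set Topology
open scoped ContDiff Manifold

/-- The space `ℝ × ℝⁿ × ℝᵐ` of triples `(t, x, u)`: time, states, inputs. -/
abbrev ControlSpace (n m : ℕ) : Type := ℝ × (Fin n → ℝ) × (Fin m → ℝ)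

/-- A smooth control system `x' = f (t, x, u)` with `n` states and `m` inputs on a nonempty open
set `M = dom` of `ℝ × ℝⁿ × ℝᵐ`. -/
structure ControlSystem (n m : ℕ) where
  /-- the manifold `M` of the system -/
  dom : Set (ControlSpace n m)
  isOpen_dom : IsOpen dom
  nonempty_dom : dom.Nonempty
  /-- the right-hand side of the system -/
  f : ControlSpace n m → (Fin n → ℝ)
  smooth_f : ContDiffOn ℝ ∞ f dom

/-- A signature `⟨ρ₁, …, ρ_k⟩`, as the list of its entries; `ρ_j` is the entry in position `j - 1`
of the list and counts functions of order `j`, for `1 ≤ j ≤ k`. -/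
abbrev Signature : Type := List ℕ

namespace Signature

/-- The labels of the functions counted by `⟨ρ₁, …, ρ_k⟩`: there are `ρ_j` labels for each `j`. -/
abbrev Label (ν : Signature) : Type := Σ j : Fin ν.length, Fin (ν.get j)

/-- The order of a labelled function; positions in the list start at `0`, orders at `1`. -/
abbrev order (ν : Signature) (a : ν.Label) : ℕ := (a.1 : ℕ) + 1

/-- The partial jet space `J^ν`, with coordinates `t` and `z^a_l` for `0 ≤ l ≤ order a`. -/
abbrev JetSpace (ν : Signature) : Type := ℝ × ((a : ν.Label) → Fin (ν.order a + 1) → ℝ)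

/-- The coordinates of `J^ν` that are states of the Brunovsky system: `t` and `z^a_l` for
`0 ≤ l < order a`. -/
def lower (ν : Signature) (q : ν.JetSpace) : ℝ × ((a : ν.Label) → Fin (ν.order a) → ℝ) :=
  (q.1, fun a l => q.2 a l.castSucc)

/-- The coordinate vector field of the top-order coordinate `z^a_{order a}`. -/
noncomputable def topVector (ν : Signature) (a : ν.Label) : ν.JetSpace :=
  (0, Pi.single a (Pi.single (Fin.last (ν.order a)) 1))

/-- The curve `t ↦ j^ν z (t)` of partial jets of a tuple of functions `z`. -/
noncomputable def jet (ν : Signature) (z : ν.Label → ℝ → ℝ) (t : ℝ) : ν.JetSpace :=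
  (t, fun a l => iteratedDeriv (l : ℕ) (z a) t)

/-- The one-form `dz^a_l - z^a_{l+1} dt` at the point `q`, for `0 ≤ l < order a`. -/
noncomputable def contactForm (ν : Signature) (q : ν.JetSpace) (a : ν.Label)
    (l : Fin (ν.order a)) : Module.Dual ℝ ν.JetSpace :=
  LinearMap.proj l.castSucc ∘ₗ
      LinearMap.proj (φ := fun c : ν.Label => Fin (ν.order c + 1) → ℝ) a ∘ₗ LinearMap.snd ℝ ℝ _
    - q.2 a l.succ • LinearMap.fst ℝ ℝ _

/-- The Brunovsky normal form (contact codistribution) `β^ν` on `J^ν`, at the point `q`. -/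
noncomputable def brunovsky (ν : Signature) (q : ν.JetSpace) :
    Submodule ℝ (Module.Dual ℝ ν.JetSpace) :=
  Submodule.span ℝ
    (range fun p : Σ a : ν.Label, Fin (ν.order a) => ν.contactForm q p.1 p.2)

end Signature

namespace ControlSystem

variable {n m : ℕ}

/-- The one-form `dx^i - f^i dt` at the point `p`. -/
noncomputable def form (S : ControlSystem n m) (p : ControlSpace n m) (i : Fin n) :
    Module.Dual ℝ (ControlSpace n m) :=
  LinearMap.proj i ∘ₗ LinearMap.fst ℝ (Fin n → ℝ) (Fin m → ℝ) ∘ₗ LinearMap.snd ℝ ℝ _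
    - S.f p i • LinearMap.fst ℝ ℝ _

/-- The Pfaffian system (codistribution) `ω = span {dx^i - f^i dt}` of the control system, at the
point `p`. -/
noncomputable def pfaffian (S : ControlSystem n m) (p : ControlSpace n m) :
    Submodule ℝ (Module.Dual ℝ (ControlSpace n m)) :=
  Submodule.span ℝ (range (S.form p))

/-- `t ↦ (t, x t, u t)` is a smooth trajectory of the system on the open interval `(a, b)`. -/
def IsTrajectory (S : ControlSystem n m) (a b : ℝ) (x : ℝ → Fin n → ℝ) (u : ℝ → Fin m → ℝ) :
    Prop :=
  ContDiffOn ℝ ∞ x (Ioo a b) ∧ ContDiffOn ℝ ∞ u (Ioo a b) ∧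
    ∀ t ∈ Ioo a b, (t, x t, u t) ∈ S.dom ∧ HasDerivAt x (S.f (t, x t, u t)) t

/-- The point `(t, x, u, u', …, u^(K))` that determines the jets of a trajectory at time `t`
up to order `K` in the inputs. -/
noncomputable def trajectoryJet (K : ℕ) (x : ℝ → Fin n → ℝ) (u : ℝ → Fin m → ℝ) (t : ℝ) :
    ControlSpace n m × (Fin K → Fin m → ℝ) :=
  ((t, x t, u t), fun j => iteratedDeriv ((j : ℕ) + 1) u t)

/-- The map `ψ`, on the open set `W` of `J^ν`, is an explicit solution (Monge parametrization) of
signature `ν` of the control system. The trajectories are `t ↦ ψ (j^ν z (t))`. Generic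
trajectories are those whose jets, up to some finite order, lie in an open dense set. -/
structure IsExplicitSolution (S : ControlSystem n m) (ν : Signature) (W : Set ν.JetSpace)
    (ψ : ν.JetSpace → ControlSpace n m) : Prop where
  isOpen : IsOpen W
  smooth : ContDiffOn ℝ ∞ ψ W
  mapsTo : MapsTo ψ W S.dom
  /-- `ψ` has the form `(t, A, B)` -/
  time : ∀ q ∈ W, (ψ q).1 = q.1
  /-- there are as many arbitrary functions as inputs -/
  card_eq : Fintype.card ν.Label = m
  /-- each arbitrary function really occurs to the order that the signature records -/
  occurs : ∀ a : ν.Label, ∃ q ∈ W, fderiv ℝ ψ q (ν.topVector a) ≠ 0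
  /-- all smooth functions with jets in `W` give trajectories -/
  isTrajectory : ∀ (a b : ℝ) (z : ν.Label → ℝ → ℝ),
    (∀ c, ContDiffOn ℝ ∞ (z c) (Ioo a b)) → (∀ t ∈ Ioo a b, ν.jet z t ∈ W) →
      S.IsTrajectory a b (fun t => (ψ (ν.jet z t)).2.1) (fun t => (ψ (ν.jet z t)).2.2)
  /-- all generic trajectories arise in this way, locally in time -/
  generic : ∃ (K : ℕ) (G : Set (ControlSpace n m × (Fin K → Fin m → ℝ))),
    IsOpen G ∧ S.dom ×ˢ univ ⊆ closure G ∧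
      ∀ (a b : ℝ) (x : ℝ → Fin n → ℝ) (u : ℝ → Fin m → ℝ), S.IsTrajectory a b x u →
        ∀ t₀ ∈ Ioo a b, trajectoryJet K x u t₀ ∈ G →
          ∃ (a' b' : ℝ) (z : ν.Label → ℝ → ℝ), t₀ ∈ Ioo a' b' ∧ Ioo a' b' ⊆ Ioo a b ∧
            (∀ c, ContDiffOn ℝ ∞ (z c) (Ioo a' b')) ∧
            ∀ t ∈ Ioo a' b', ν.jet z t ∈ W ∧ ψ (ν.jet z t) = (t, x t, u t)

/-- The map `φ`, on the open set `W` of `J^ν`, is a static feedback linearization of the control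
system: a local diffeomorphism, locally of the form `(t, z, v) ↦ (t, θ (t, z), χ (t, z, v))` with
`z` the states and `v` the inputs of the Brunovsky normal form `β^ν`, that identifies the two
systems. It reaches generic points of the manifold of the system. -/
structure IsStaticFeedbackLinearization (S : ControlSystem n m) (ν : Signature)
    (W : Set ν.JetSpace) (φ : ν.JetSpace → ControlSpace n m) : Prop where
  isOpen : IsOpen W
  mapsTo : MapsTo φ W S.dom
  dense : S.dom ⊆ closure (φ '' W)
  card_eq : Fintype.card ν.Label = m
  localDiffeo : IsLocalDiffeomorphOn 𝓘(ℝ, ν.JetSpace) 𝓘(ℝ, ControlSpace n m) ∞ φ W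
  time : ∀ q ∈ W, (φ q).1 = q.1
  states : ∀ q ∈ W, ∃ N ∈ 𝓝 q,
    ∃ θ : ℝ × ((a : ν.Label) → Fin (ν.order a) → ℝ) → (Fin n → ℝ),
      ∀ p ∈ N, (φ p).2.1 = θ (ν.lower p)
  /-- `φ^* ω = β^ν` -/
  pullback : ∀ q ∈ W,
    (S.pfaffian (φ q)).map (fderiv ℝ φ q : ν.JetSpace →ₗ[ℝ] ControlSpace n m).dualMap
      = ν.brunovsky q

/-- The system is static feedback linearizable. -/
def IsSFL (S : ControlSystem n m) : Prop :=
  ∃ (ν : Signature) (W : Set ν.JetSpace) (φ : ν.JetSpace → ControlSpace n m),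
    S.IsStaticFeedbackLinearization ν W φ

end ControlSystem

/-! A point `q` of `J^ν` together with arbitrary next derivatives `w` is always the jet of
polynomial functions, so the requirement that jets go to trajectories is pointwise: the differential
of `ψ` sends every velocity `prolong q w` to a vector with x-part `f` (`fderiv_prolong`). These
velocities span the annihilator of `β^ν`, so `ψ^* ω ⊆ β^ν` on all of `W`, in any dimension. Likewise
the top-order directions do not move `x`.

Since there are `m` labels, equality of dimensions means that the orders sum to `n`. Where the
differential is invertible, `ψ^* ω` then has dimension `n` and `β^ν` at most `n`, so they agree;
`W'` is the set of these regular points. Its image is dense by Sard's theorem: trajectories pass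
through every point of `M`, so genericity puts open sets arbitrarily near each point of `M` inside
the image of `ψ`.

Conversely, an invertible differential forces equal dimensions. For (ii), a linearization is itself
an explicit solution: a trajectory lifts through a local inverse to a curve tangent to the contact
distribution, which is a curve of jets. -/

/-! ### Calculus: Taylor data, Sard's theorem, local inverses. -/

/-- Finitely many derivatives of a smooth function at a point can be prescribed. -/
theorem exists_contDiff_iteratedDeriv_eq {F : Type*} [NormedAddCommGroup F] [NormedSpace ℝ F]
    (N : ℕ) (c : ℕ → F) (t₀ : ℝ) :
    ∃ p : ℝ → F, ContDiff ℝ ∞ p ∧ ∀ k < N, iteratedDeriv k p t₀ = c k := by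
  refine ⟨fun t => ∑ j ∈ Finset.range N, ((t - t₀) ^ j) • ((j.factorial : ℝ)⁻¹ • c j),
    by fun_prop, fun k hk => ?_⟩
  have h1 : ∀ j : ℕ, iteratedDeriv k (fun t : ℝ => ((t - t₀) ^ j) • ((j.factorial : ℝ)⁻¹ • c j)) t₀
      = if k = j then c j else 0 := by
    intro j
    rw [iteratedDeriv_comp_sub_const k (fun t : ℝ => t ^ j • ((j.factorial : ℝ)⁻¹ • c j)) t₀]
    simp only [sub_self]
    rw [iteratedDeriv_smul_const (f := fun t : ℝ => t ^ j) (by fun_prop), iteratedDeriv_fun_pow_zero]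
    split_ifs
    · rw [smul_smul, mul_inv_cancel₀ (by positivity), one_smul]
    · simp
  rw [iteratedDeriv_fun_sum (fun j _ => by fun_prop)]
  simp only [h1]
  simp [hk]

theorem ContDiffOn.iteratedDeriv_of_isOpen {F : Type*} [NormedAddCommGroup F] [NormedSpace ℝ F]
    {f : ℝ → F} {s : Set ℝ} (hf : ContDiffOn ℝ ∞ f s) (hs : IsOpen s) (k : ℕ) :
    ContDiffOn ℝ ∞ (iteratedDeriv k f) s := by
  induction k with
  | zero => simpa using hf
  | succ k ih =>
    rw [iteratedDeriv_succ]
    exact ((contDiffOn_infty_iff_deriv_of_isOpen hs).1 ih).2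

/-- Integral curves of a smooth vector field are smooth. -/
theorem contDiffOn_infty_of_hasDerivAt {E : Type*} [NormedAddCommGroup E] [NormedSpace ℝ E]
    {v : E → E} {U : Set E} {α : ℝ → E} {s : Set ℝ} (hs : IsOpen s) (hv : ContDiffOn ℝ ∞ v U)
    (hα : ∀ t ∈ s, HasDerivAt α (v (α t)) t) (hU : MapsTo α s U) : ContDiffOn ℝ ∞ α s := by
  rw [contDiffOn_infty]
  intro k
  induction k with
  | zero =>
    exact contDiffOn_zero.2 fun t ht => (hα t ht).continuousAt.continuousWithinAt
  | succ k ih =>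
    push_cast
    rw [contDiffOn_succ_iff_deriv_of_isOpen hs]
    refine ⟨fun t ht => (hα t ht).differentiableAt.differentiableWithinAt, by simp, ?_⟩
    -- Bootstrapping: if `α` is `C^k`, so is its derivative `v ∘ α`.
    exact ((contDiffOn_infty.1 hv k).comp ih hU).congr fun t ht => (hα t ht).deriv

/-- A continuous linear map between spaces of equal finite dimension is either an equivalence, or
has zero determinant after any identification of the spaces. -/
theorem ContinuousLinearMap.det_comp_eq_zero_of_notMem_range {E F : Type*} [NormedAddCommGroup E]
    [NormedSpace ℝ E] [FiniteDimensional ℝ E] [NormedAddCommGroup F] [NormedSpace ℝ F]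
    (L : F ≃L[ℝ] E) {A : E →L[ℝ] F}
    (hA : A ∉ range ((↑) : (E ≃L[ℝ] F) → E →L[ℝ] F)) :
    ((L : F →L[ℝ] E).comp A).det = 0 := by
  by_contra h
  refine hA ⟨(ContinuousLinearMap.toContinuousLinearEquivOfDetNeZero _ h).trans L.symm, ?_⟩
  ext x
  simp

/-- Sard's theorem in equal dimensions: if the image of a differentiable map contains a nonempty
open set, then this set contains the value of the map at a regular point. -/
theorem exists_fderiv_mem_range_of_isOpen_subset_image {E F : Type*} [NormedAddCommGroup E]
    [NormedSpace ℝ E] [FiniteDimensional ℝ E] [NormedAddCommGroup F] [NormedSpace ℝ F]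
    [FiniteDimensional ℝ F] (hd : Module.finrank ℝ F = Module.finrank ℝ E) {f : E → F} {W : Set E}
    (hf : ∀ q ∈ W, DifferentiableAt ℝ f q) {U : Set F} (hU : IsOpen U) (hne : U.Nonempty)
    (hsub : U ⊆ f '' W) :
    ∃ q ∈ W, f q ∈ U ∧ fderiv ℝ f q ∈ range ((↑) : (E ≃L[ℝ] F) → E →L[ℝ] F) := by
  by_contra! h
  -- The measure-zero theorem needs self-maps of one space, hence the identification.
  let L : F ≃L[ℝ] E := ContinuousLinearEquiv.ofFinrankEq hd
  borelize E
  have hnull := MeasureTheory.addHaar_image_eq_zero_of_det_fderivWithin_eq_zero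
    (MeasureTheory.Measure.addHaar (G := E)) (s := W ∩ f ⁻¹' U) (f := fun q => L (f q))
    (f' := fun q => (L : F →L[ℝ] E).comp (fderiv ℝ f q))
    (fun q hq => ((L : F →L[ℝ] E).hasFDerivAt.comp q
      (hf q hq.1).hasFDerivAt).hasFDerivWithinAt)
    (fun q hq => ContinuousLinearMap.det_comp_eq_zero_of_notMem_range L (h q hq.1 hq.2))
  refine (IsOpen.measure_pos (MeasureTheory.Measure.addHaar (G := E)) (U := L '' U)
    (L.toHomeomorph.isOpenMap U hU) (hne.image L)).ne' (MeasureTheory.measure_mono_null ?_ hnull)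
  rintro _ ⟨y, hy, rfl⟩
  obtain ⟨q, hq, rfl⟩ := hsub hy
  exact ⟨q, ⟨hq, hy⟩, rfl⟩

/-- The inverse function theorem: a smooth map is a local diffeomorphism where its derivative is
invertible. -/
theorem isLocalDiffeomorphOn_of_fderiv_mem_range {E F : Type*} [NormedAddCommGroup E]
    [NormedSpace ℝ E] [CompleteSpace E] [NormedAddCommGroup F] [NormedSpace ℝ F]
    {f : E → F} {W : Set E} (hW : IsOpen W) (hf : ContDiffOn ℝ ∞ f W)
    (hreg : ∀ q ∈ W, fderiv ℝ f q ∈ range ((↑) : (E ≃L[ℝ] F) → E →L[ℝ] F)) :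
    IsLocalDiffeomorphOn 𝓘(ℝ, E) 𝓘(ℝ, F) ∞ f W := by
  rintro ⟨q, hq⟩
  have hat : ∀ p ∈ W, ContDiffAt ℝ ∞ f p := fun p hp => hf.contDiffAt (hW.mem_nhds hp)
  have hder : ∀ p ∈ W, ∃ e : E ≃L[ℝ] F, HasFDerivAt f (e : E →L[ℝ] F) p := fun p hp => by
    obtain ⟨e, he⟩ := hreg p hp
    exact ⟨e, he ▸ ((hat p hp).differentiableAt (by simp)).hasFDerivAt⟩
  obtain ⟨e, he⟩ := hder q hq
  -- Restricting to `W` keeps the derivative invertible on the whole source, which makes the inverse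
  -- smooth on the whole target.
  let Φ := ((hat q hq).toOpenPartialHomeomorph f he (by simp)).restrOpen W hW
  have hΦ : Φ.source ⊆ W := fun p hp => by
    rw [OpenPartialHomeomorph.restrOpen_source] at hp
    exact hp.2
  refine ⟨⟨Φ.toPartialEquiv, Φ.open_source, Φ.open_target, ?_, ?_⟩, ?_, fun p _ => rfl⟩
  · exact contMDiffOn_iff_contDiffOn.2 (hf.mono hΦ)
  · refine contMDiffOn_iff_contDiffOn.2 fun y hy => ContDiffAt.contDiffWithinAt ?_
    have hy' := hΦ (Φ.map_target hy)
    obtain ⟨e', he'⟩ := hder _ hy'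
    exact Φ.contDiffAt_symm hy he' (hat _ hy')
  · show q ∈ Φ.source
    rw [OpenPartialHomeomorph.restrOpen_source]
    exact ⟨(hat q hq).mem_toOpenPartialHomeomorph_source he (by simp), hq⟩

theorem IsLocalDiffeomorphAt.fderiv_mem_range {E F : Type*} [NormedAddCommGroup E]
    [NormedSpace ℝ E] [NormedAddCommGroup F] [NormedSpace ℝ F] {f : E → F} {q : E}
    (hf : IsLocalDiffeomorphAt 𝓘(ℝ, E) 𝓘(ℝ, F) ∞ f q) :
    fderiv ℝ f q ∈ range ((↑) : (E ≃L[ℝ] F) → E →L[ℝ] F) := by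
  refine ⟨hf.mfderivToContinuousLinearEquiv (by simp), ?_⟩
  rw [← mfderiv_eq_fderiv]
  rfl

/-- A smooth local section of a local diffeomorphism, with values in a given neighbourhood. -/
theorem IsLocalDiffeomorphAt.exists_section {E F : Type*} [NormedAddCommGroup E]
    [NormedSpace ℝ E] [NormedAddCommGroup F] [NormedSpace ℝ F] {f : E → F} {q : E}
    (hf : IsLocalDiffeomorphAt 𝓘(ℝ, E) 𝓘(ℝ, F) ∞ f q) {W : Set E} (hW : IsOpen W) (hq : q ∈ W) :
    ∃ (V : Set F) (g : F → E), IsOpen V ∧ f q ∈ V ∧ ContDiffOn ℝ ∞ g V ∧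
      ∀ y ∈ V, g y ∈ W ∧ f (g y) = y := by
  obtain ⟨Φ, hqΦ, heq⟩ := hf
  have hinv : ContDiffOn ℝ ∞ Φ.invFun Φ.target := contMDiffOn_iff_contDiffOn.1 Φ.contMDiffOn_invFun
  refine ⟨Φ.target ∩ Φ.invFun ⁻¹' W, Φ.invFun,
    hinv.continuousOn.isOpen_inter_preimage Φ.open_target hW, ⟨?_, ?_⟩, hinv.mono inter_subset_left,
    fun y hy => ⟨hy.2, ?_⟩⟩
  · rw [heq hqΦ]; exact Φ.map_source' hqΦ
  · rw [mem_preimage, heq hqΦ]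
    exact (Φ.left_inv' hqΦ).symm ▸ hq
  · rw [heq (Φ.map_target' hy.1)]
    exact Φ.right_inv' hy.1

/-- A vector killed by a family of functionals is killed by their span. -/
theorem Module.Dual.apply_eq_zero_of_mem_span {V ι : Type*} [AddCommGroup V] [Module ℝ V]
    {F : ι → Module.Dual ℝ V} {v : V} (hv : ∀ i, F i v = 0) {ξ : Module.Dual ℝ V}
    (hξ : ξ ∈ Submodule.span ℝ (range F)) : ξ v = 0 := by
  induction hξ using Submodule.span_induction with
  | mem ξ h => obtain ⟨i, rfl⟩ := h; exact hv i
  | zero => rfl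
  | add ξ η _ _ h1 h2 => simp [h1, h2]
  | smul c ξ _ h => simp [h]

theorem HasDerivAt.prod_fst {E F : Type*} [NormedAddCommGroup E] [NormedSpace ℝ E]
    [NormedAddCommGroup F] [NormedSpace ℝ F] {c : ℝ → E × F} {c' : E × F} {t : ℝ}
    (h : HasDerivAt c c' t) : HasDerivAt (fun s => (c s).1) c'.1 t :=
  (ContinuousLinearMap.fst ℝ E F).hasFDerivAt.comp_hasDerivAt t h

theorem HasDerivAt.prod_snd {E F : Type*} [NormedAddCommGroup E] [NormedSpace ℝ E]
    [NormedAddCommGroup F] [NormedSpace ℝ F] {c : ℝ → E × F} {c' : E × F} {t : ℝ}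
    (h : HasDerivAt c c' t) : HasDerivAt (fun s => (c s).2) c'.2 t :=
  (ContinuousLinearMap.snd ℝ E F).hasFDerivAt.comp_hasDerivAt t h

/-! ### Jets and the contact distribution. -/

namespace Signature

variable (ν : Signature)

theorem finrank_jetSpace :
    Module.finrank ℝ ν.JetSpace = 1 + (∑ a : ν.Label, ν.order a + Fintype.card ν.Label) := by
  rw [Module.finrank_prod, Module.finrank_pi_fintype]
  simp only [Module.finrank_self, Module.finrank_fin_fun, Finset.sum_add_distrib,
    Finset.sum_const, Finset.card_univ, smul_eq_mul, mul_one]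

theorem contactForm_apply (q : ν.JetSpace) (a : ν.Label) (l : Fin (ν.order a)) (X : ν.JetSpace) :
    ν.contactForm q a l X = X.2 a l.castSucc - q.2 a l.succ * X.1 := rfl

/-- The velocity of a curve of jets through `q` whose derivatives of the first order beyond the
jet are `w`. -/
def prolong (q : ν.JetSpace) (w : ν.Label → ℝ) : ν.JetSpace :=
  (1, fun a => Fin.snoc (α := fun _ => ℝ) (fun l : Fin (ν.order a) => q.2 a l.succ) (w a))

theorem prolong_castSucc (q : ν.JetSpace) (w : ν.Label → ℝ) (a : ν.Label) (l : Fin (ν.order a)) :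
    (ν.prolong q w).2 a l.castSucc = q.2 a l.succ := by
  simp [prolong]

theorem prolong_last (q : ν.JetSpace) (w : ν.Label → ℝ) (a : ν.Label) :
    (ν.prolong q w).2 a (Fin.last (ν.order a)) = w a := by
  simp [prolong]

/-- A vector annihilated by the contact forms is a combination of velocities of jets. -/
theorem eq_prolong_of_contactForm_eq_zero {q X : ν.JetSpace}
    (hX : ∀ a l, ν.contactForm q a l X = 0) :
    X = X.1 • ν.prolong q 0
      + (ν.prolong q (fun a => X.2 a (Fin.last (ν.order a))) - ν.prolong q 0) := by
  refine Prod.ext (by simp [prolong]) (funext fun a => funext fun l => ?_)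
  simp only [Prod.snd_add, Prod.smul_snd, Prod.snd_sub, Pi.add_apply, Pi.smul_apply, Pi.sub_apply]
  induction l using Fin.lastCases with
  | last => simp [prolong_last]
  | cast l =>
    have := hX a l
    rw [contactForm_apply] at this
    simp only [prolong_castSucc, smul_eq_mul]
    linarith

variable {ν}

theorem contDiffOn_jet {z : ν.Label → ℝ → ℝ} {s : Set ℝ} (hs : IsOpen s)
    (hz : ∀ c, ContDiffOn ℝ ∞ (z c) s) : ContDiffOn ℝ ∞ (ν.jet z) s :=
  contDiffOn_id.prodMk (contDiffOn_pi.2 fun a => contDiffOn_pi.2 fun l =>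
    (hz a).iteratedDeriv_of_isOpen hs l)

theorem hasDerivAt_jet {z : ν.Label → ℝ → ℝ} {s : Set ℝ} (hs : IsOpen s)
    (hz : ∀ c, ContDiffOn ℝ ∞ (z c) s) {t : ℝ} (ht : t ∈ s) :
    HasDerivAt (ν.jet z)
      (ν.prolong (ν.jet z t) fun a => iteratedDeriv (ν.order a + 1) (z a) t) t := by
  refine HasDerivAt.prodMk (hasDerivAt_id t) (hasDerivAt_pi.2 fun a => hasDerivAt_pi.2 fun l => ?_)
  have h : HasDerivAt (iteratedDeriv (l : ℕ) (z a)) (iteratedDeriv ((l : ℕ) + 1) (z a) t) t := by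
    rw [iteratedDeriv_succ]
    exact ((((hz a).iteratedDeriv_of_isOpen hs l).contDiffAt
      (hs.mem_nhds ht)).differentiableAt (by simp)).hasDerivAt
  refine h.congr_deriv (Eq.symm ?_)
  induction l using Fin.lastCases with
  | last => simp
  | cast l => simp [jet]

/-- Every point of a partial jet space, with one more derivative, is a jet of smooth functions. -/
theorem exists_jet_eq (q : ν.JetSpace) (w : ν.Label → ℝ) :
    ∃ z : ν.Label → ℝ → ℝ, (∀ c, ContDiff ℝ ∞ (z c)) ∧ ν.jet z q.1 = q ∧
      ∀ a, iteratedDeriv (ν.order a + 1) (z a) q.1 = w a := by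
  -- Orders `0` to `order a` come from `q`; the one extra order, `order a + 1`, carries `w a`.
  choose z hz hk using fun a : ν.Label => exists_contDiff_iteratedDeriv_eq (ν.order a + 2)
    (fun k => if h : k < ν.order a + 1 then q.2 a ⟨k, h⟩ else w a) q.1
  refine ⟨z, hz, Prod.ext rfl (funext fun a => funext fun l => ?_), fun a => ?_⟩
  · show iteratedDeriv (l : ℕ) (z a) q.1 = _
    rw [hk a l (by omega), dif_pos l.2]
  · rw [hk a _ (by omega), dif_neg (by omega)]

/-- A curve tangent to the contact distribution and parametrized by `t` is a curve of jets. -/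
theorem jet_eq_of_hasDerivAt {s : Set ℝ} (hs : IsOpen s) {c : ℝ → ν.JetSpace}
    (hc : ∀ t ∈ s, DifferentiableAt ℝ c t) (h1 : ∀ t ∈ s, (c t).1 = t)
    (hcon : ∀ t ∈ s, ∀ a l, ν.contactForm (c t) a l (deriv c t) = 0) {t : ℝ} (ht : t ∈ s) :
    ν.jet (fun a t => (c t).2 a 0) t = c t := by
  have hd : ∀ t ∈ s, (deriv c t).1 = 1 := fun t ht =>
    ((hc t ht).hasDerivAt.prod_fst.congr_of_eventuallyEq
      (Filter.eventually_of_mem (hs.mem_nhds ht) fun y hy => (h1 y hy).symm)).unique (hasDerivAt_id t)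
  have key : ∀ (a : ν.Label) (k : ℕ) (hk : k < ν.order a + 1), ∀ t ∈ s,
      iteratedDeriv k (fun t => (c t).2 a 0) t = (c t).2 a ⟨k, hk⟩ := by
    intro a k
    induction k with
    | zero => intro hk t ht; simp
    | succ k ih =>
      intro hk t ht
      have hk' : k < ν.order a := by omega
      rw [iteratedDeriv_succ, Filter.EventuallyEq.deriv_eq
        (Filter.eventually_of_mem (hs.mem_nhds ht) (ih (by omega)))]
      have h2 := hasDerivAt_pi.1 (hasDerivAt_pi.1 (hc t ht).hasDerivAt.prod_snd a) ⟨k, by omega⟩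
      rw [h2.deriv]
      -- As `dt` takes the value `1` on the velocity, the contact form says that the next coordinate
      -- is the derivative of this one.
      have h3 := hcon t ht a ⟨k, hk'⟩
      rw [contactForm_apply, hd t ht, mul_one, sub_eq_zero] at h3
      exact h3
  exact Prod.ext (h1 t ht).symm (funext fun a => funext fun l => key a l l.2 t ht)

theorem finrank_brunovsky_le (q : ν.JetSpace) :
    Module.finrank ℝ (ν.brunovsky q) ≤ ∑ a : ν.Label, ν.order a := by
  refine (finrank_range_le_card _).trans ?_
  simp

end Signature

/-! ### The Pfaffian system and existence of trajectories. -/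

namespace ControlSystem

variable {n m : ℕ} (S : ControlSystem n m)

theorem form_apply (p : ControlSpace n m) (i : Fin n) (v : ControlSpace n m) :
    S.form p i v = v.2.1 i - S.f p i * v.1 := rfl

theorem finrank_controlSpace : Module.finrank ℝ (ControlSpace n m) = 1 + (n + m) := by
  simp

theorem finrank_pfaffian (p : ControlSpace n m) : Module.finrank ℝ (S.pfaffian p) = n := by
  have hli : LinearIndependent ℝ (S.form p) := by
    rw [Fintype.linearIndependent_iff]
    intro g hg i
    have := LinearMap.congr_fun hg (0, Pi.single i 1, 0)
    simpa [form_apply, LinearMap.sum_apply, Pi.single_apply] using this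
  exact (finrank_span_eq_card hli).trans (Fintype.card_fin n)

/-- There is a trajectory through every point, with any derivatives of the inputs. -/
theorem exists_isTrajectory {p : ControlSpace n m} (hp : p ∈ S.dom) (K : ℕ)
    (v : Fin K → Fin m → ℝ) :
    ∃ a b x u, S.IsTrajectory a b x u ∧ p.1 ∈ Ioo a b ∧ trajectoryJet K x u p.1 = (p, v) := by
  -- Fix an input with the wanted derivatives, shifted by one because `v` starts at the first
  -- derivative. With time as an extra state, what remains is an autonomous equation for
  -- Picard–Lindelöf.
  obtain ⟨u, hu, huk⟩ := exists_contDiff_iteratedDeriv_eq (K + 1)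
    (fun k => if h : k = 0 then p.2.2 else if h : k - 1 < K then v ⟨k - 1, h⟩ else 0) p.1
  have hu0 : u p.1 = p.2.2 := by simpa using huk 0 (by omega)
  let ι : ℝ × (Fin n → ℝ) → ControlSpace n m := fun y => (y.1, y.2, u y.1)
  have hι : ContDiff ℝ ∞ ι :=
    contDiff_fst.prodMk (contDiff_snd.prodMk (hu.comp contDiff_fst))
  let V : ℝ × (Fin n → ℝ) → ℝ × (Fin n → ℝ) := fun y => (1, S.f (ι y))
  have hU : IsOpen (ι ⁻¹' S.dom) := S.isOpen_dom.preimage hι.continuous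
  have hV : ContDiffOn ℝ ∞ V (ι ⁻¹' S.dom) :=
    contDiffOn_const.prodMk (S.smooth_f.comp hι.contDiffOn fun _ h => h)
  have hp0 : ((p.1, p.2.1) : ℝ × (Fin n → ℝ)) ∈ ι ⁻¹' S.dom := by
    show (p.1, p.2.1, u p.1) ∈ S.dom
    rw [hu0]; exact hp
  obtain ⟨α, hα0, ε, hε, hα⟩ :=
    ((hV.contDiffAt (hU.mem_nhds hp0)).of_le
      (by simp)).exists_forall_mem_closedBall_exists_eq_forall_mem_Ioo_hasDerivAt₀ p.1
  have hcont : ContinuousAt α p.1 := (hα p.1 ⟨by linarith, by linarith⟩).continuousAt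
  obtain ⟨δ, hδ, hball⟩ := Metric.mem_nhds_iff.1
    (hcont.preimage_mem_nhds (hα0.symm ▸ hU.mem_nhds hp0))
  rw [Real.ball_eq_Ioo] at hball
  set r := min ε δ
  have hr : 0 < r := lt_min hε hδ
  have hmem : p.1 ∈ Ioo (p.1 - r) (p.1 + r) := ⟨by linarith, by linarith⟩
  have hαr : ∀ t ∈ Ioo (p.1 - r) (p.1 + r), HasDerivAt α (V (α t)) t := fun t ht =>
    hα t ⟨by linarith [ht.1, min_le_left ε δ], by linarith [ht.2, min_le_left ε δ]⟩
  have hαU : MapsTo α (Ioo (p.1 - r) (p.1 + r)) (ι ⁻¹' S.dom) := fun t ht =>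
    hball ⟨by linarith [ht.1, min_le_right ε δ], by linarith [ht.2, min_le_right ε δ]⟩
  have htime : ∀ t ∈ Ioo (p.1 - r) (p.1 + r), (α t).1 = t := by
    intro t ht
    refine isOpen_Ioo.eqOn_of_deriv_eq (f := fun t => (α t).1) (g := id)
      isPreconnected_Ioo (fun t ht => (hαr t ht).prod_fst.differentiableAt.differentiableWithinAt)
      differentiableOn_id (fun t ht => ?_) hmem (by simp [hα0]) ht
    rw [(hαr t ht).prod_fst.deriv]
    simp [V]
  have hsm := contDiffOn_infty_of_hasDerivAt isOpen_Ioo hV hαr hαU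
  refine ⟨p.1 - r, p.1 + r, fun t => (α t).2, u, ⟨contDiff_snd.comp_contDiffOn hsm,
    hu.contDiffOn, fun t ht => ?_⟩, hmem, ?_⟩
  · have hι' : (t, (α t).2, u t) = ι (α t) := by simp only [ι, htime t ht]
    rw [hι']
    exact ⟨hαU ht, (hαr t ht).prod_snd⟩
  · refine Prod.ext (Prod.ext rfl (Prod.ext ?_ hu0)) (funext fun j => ?_)
    · show (α p.1).2 = p.2.1
      rw [hα0]
    · show iteratedDeriv ((j : ℕ) + 1) u p.1 = v j
      rw [huk _ (by omega)]
      simp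

/-! ### From explicit solutions to linearizations. -/

namespace IsExplicitSolution

variable {S} {ν : Signature} {W : Set ν.JetSpace} {ψ : ν.JetSpace → ControlSpace n m}

theorem differentiableAt (h : S.IsExplicitSolution ν W ψ) {q : ν.JetSpace} (hq : q ∈ W) :
    DifferentiableAt ℝ ψ q :=
  (h.smooth.contDiffAt (h.isOpen.mem_nhds hq)).differentiableAt (by simp)

theorem fderiv_fst (h : S.IsExplicitSolution ν W ψ) {q : ν.JetSpace} (hq : q ∈ W)
    (X : ν.JetSpace) : (fderiv ℝ ψ q X).1 = X.1 := by
  have h1 : HasFDerivAt (fun p => (ψ p).1)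
      ((ContinuousLinearMap.fst ℝ _ _).comp (fderiv ℝ ψ q)) q :=
    (h.differentiableAt hq).hasFDerivAt.fst
  have h2 : HasFDerivAt (fun p => (ψ p).1) (ContinuousLinearMap.fst ℝ ℝ _) q :=
    hasFDerivAt_fst.congr_of_eventuallyEq
      (Filter.eventually_of_mem (h.isOpen.mem_nhds hq) h.time)
  exact DFunLike.congr_fun (h1.unique h2) X

/-- Differentiate `ψ` along a curve of jets realising `q` and `w`. The right-hand side is free of
`w`, which is what later kills the top-order directions. -/
theorem fderiv_prolong (h : S.IsExplicitSolution ν W ψ) {q : ν.JetSpace} (hq : q ∈ W)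
    (w : ν.Label → ℝ) : (fderiv ℝ ψ q (ν.prolong q w)).2.1 = S.f (ψ q) := by
  obtain ⟨z, hz, hzq, hzw⟩ := Signature.exists_jet_eq q w
  have hjet := Signature.hasDerivAt_jet isOpen_univ (fun c => (hz c).contDiffOn) (mem_univ q.1)
  have hcont : ContinuousAt (ν.jet z) q.1 := hjet.continuousAt
  obtain ⟨δ, hδ, hball⟩ := Metric.mem_nhds_iff.1
    (hcont.preimage_mem_nhds (hzq.symm ▸ h.isOpen.mem_nhds hq))
  rw [Real.ball_eq_Ioo] at hball
  obtain ⟨-, -, htr⟩ := h.isTrajectory (q.1 - δ) (q.1 + δ) z (fun c => (hz c).contDiffOn) hball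
  have h1 := (htr q.1 ⟨by linarith, by linarith⟩).2
  simp only [hzq, hzw] at h1 hjet
  have hψ : ((q.1, (ψ q).2.1, (ψ q).2.2) : ControlSpace n m) = ψ q := by
    rw [← h.time q hq]
  rw [hψ] at h1
  have h2 := ((h.differentiableAt hq).hasFDerivAt.comp_hasDerivAt_of_eq q.1 hjet hzq.symm).prod_snd.prod_fst
  exact h2.unique h1

/-- The pullback of `ω` is contained in `β^ν`, on the level of annihilators. -/
theorem form_fderiv_eq_zero (h : S.IsExplicitSolution ν W ψ) {q : ν.JetSpace} (hq : q ∈ W)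
    {X : ν.JetSpace} (hX : ∀ a l, ν.contactForm q a l X = 0) (i : Fin n) :
    S.form (ψ q) i (fderiv ℝ ψ q X) = 0 := by
  rw [form_apply, h.fderiv_fst hq]
  -- The two velocities in the difference have the same x-image, so only the multiple of `prolong q
  -- 0` survives.
  conv_lhs => rw [ν.eq_prolong_of_contactForm_eq_zero hX]
  simp only [map_add, map_smul, map_sub, Prod.snd_add, Prod.fst_add, Prod.smul_snd, Prod.smul_fst,
    Prod.snd_sub, Prod.fst_sub, Pi.add_apply, Pi.sub_apply, Pi.smul_apply, h.fderiv_prolong hq,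
    smul_eq_mul]
  simp [Signature.prolong, mul_comm]

theorem map_pfaffian_le (h : S.IsExplicitSolution ν W ψ) {q : ν.JetSpace} (hq : q ∈ W) :
    (S.pfaffian (ψ q)).map (fderiv ℝ ψ q : ν.JetSpace →ₗ[ℝ] ControlSpace n m).dualMap
      ≤ ν.brunovsky q := by
  rw [pfaffian, Submodule.map_span, Submodule.span_le]
  rintro _ ⟨_, ⟨i, rfl⟩, rfl⟩
  refine mem_span_of_iInf_ker_le_ker fun X hX => ?_
  rw [Submodule.mem_iInf] at hX
  exact h.form_fderiv_eq_zero hq (fun a l => hX ⟨a, l⟩) i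

/-- The states depend only on the states of the Brunovsky normal form, locally. -/
theorem exists_states (h : S.IsExplicitSolution ν W ψ) {q : ν.JetSpace} (hq : q ∈ W) :
    ∃ N ∈ 𝓝 q, ∃ θ : ℝ × ((a : ν.Label) → Fin (ν.order a) → ℝ) → (Fin n → ℝ),
      ∀ p ∈ N, (ψ p).2.1 = θ (ν.lower p) := by
  obtain ⟨r, hr, hball⟩ := Metric.isOpen_iff.1 h.isOpen q hq
  -- `σ` restores the top coordinates from the centre `q`; in the sup norm this cannot leave the
  -- ball.
  let σ : ℝ × ((a : ν.Label) → Fin (ν.order a) → ℝ) → ν.JetSpace := fun y =>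
    (y.1, fun a => Fin.snoc (α := fun _ => ℝ) (y.2 a) (q.2 a (Fin.last _)))
  have hσl : ∀ y a, (σ y).2 a (Fin.last _) = q.2 a (Fin.last _) := fun y a =>
    Fin.snoc_last (α := fun _ => ℝ) _ _
  have hσc : ∀ y a l, (σ y).2 a (Fin.castSucc l) = y.2 a l := fun y a l =>
    Fin.snoc_castSucc (α := fun _ => ℝ) _ _ _
  refine ⟨Metric.ball q r, Metric.ball_mem_nhds q hr, fun y => (ψ (σ y)).2.1, fun p hp => ?_⟩
  have hσp : σ (ν.lower p) ∈ Metric.ball q r := by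
    rw [Metric.mem_ball, Prod.dist_eq, max_lt_iff, dist_pi_lt_iff hr] at hp ⊢
    refine ⟨hp.1, fun a => ?_⟩
    have := hp.2 a
    rw [dist_pi_lt_iff hr] at this ⊢
    intro l
    induction l using Fin.lastCases with
    | last => rw [hσl, dist_self]; exact hr
    | cast l => rw [hσc]; exact this l.castSucc
  funext i
  have hder : ∀ y ∈ Metric.ball q r, HasFDerivWithinAt (fun p => (ψ p).2.1 i)
      ((ContinuousLinearMap.proj (R := ℝ) (φ := fun _ : Fin n => ℝ) i).comp
        ((ContinuousLinearMap.fst ℝ _ _).comp ((ContinuousLinearMap.snd ℝ _ _).comp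
          (fderiv ℝ ψ y)))) (Metric.ball q r) y := fun y hy =>
    (hasFDerivAt_pi'.1 (h.differentiableAt (hball hy)).hasFDerivAt.snd.fst i).hasFDerivWithinAt
  obtain ⟨y, hy, hyeq⟩ := domain_mvt hder (convex_ball q r) hσp hp
  have hyW := hball ((convex_ball q r).segment_subset hσp hp hy)
  rw [← sub_eq_zero]
  refine hyeq.trans ?_
  have hX1 : (p - σ (ν.lower p)).1 = 0 := sub_self p.1
  -- The difference has only top-order components, so every contact form and `dt` vanish on it at
  -- any base point.
  have := h.form_fderiv_eq_zero hyW (X := p - σ (ν.lower p)) (fun a l => by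
    rw [Signature.contactForm_apply, hX1, mul_zero, sub_zero, Prod.snd_sub, Pi.sub_apply,
      Pi.sub_apply, hσc]
    exact sub_self _) i
  rw [form_apply, h.fderiv_fst hyW, hX1, mul_zero, sub_zero] at this
  exact this

/-- The values of an explicit solution at its regular points are dense. -/
theorem exists_fderiv_mem_range (h : S.IsExplicitSolution ν W ψ)
    (hd : Module.finrank ℝ (ControlSpace n m) = Module.finrank ℝ ν.JetSpace)
    {U : Set (ControlSpace n m)} (hU : IsOpen U) (hne : (U ∩ S.dom).Nonempty) :
    ∃ q ∈ W, ψ q ∈ U ∧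
      fderiv ℝ ψ q ∈ range ((↑) : (ν.JetSpace ≃L[ℝ] ControlSpace n m) → _ →L[ℝ] _) := by
  obtain ⟨K, G, hG, hGd, hgen⟩ := h.generic
  obtain ⟨p, hpU, hpd⟩ := hne
  obtain ⟨⟨p', v⟩, ⟨⟨hp'U, hp'd⟩, -⟩, hp'G⟩ := mem_closure_iff.1
    (hGd (show (p, (0 : Fin K → Fin m → ℝ)) ∈ S.dom ×ˢ univ from ⟨hpd, mem_univ _⟩))
    ((U ∩ S.dom) ×ˢ univ) ((hU.inter S.isOpen_dom).prod isOpen_univ) ⟨⟨hpU, hpd⟩, mem_univ _⟩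
  -- Freezing the input derivatives at `v` turns `G` into an open set of points of `M`, each met by
  -- a generic trajectory and hence in the image of `ψ`.
  have hO : IsOpen ((U ∩ S.dom) ∩ (fun y => (y, v)) ⁻¹' G) :=
    (hU.inter S.isOpen_dom).inter (hG.preimage (by fun_prop))
  obtain ⟨q, hq, hqU, hreg⟩ := exists_fderiv_mem_range_of_isOpen_subset_image hd
    (fun q hq => h.differentiableAt hq) hO ⟨p', ⟨hp'U, hp'd⟩, hp'G⟩ (fun y hy => by
      obtain ⟨a, b, x, u, htr, hmem, hjet⟩ := S.exists_isTrajectory hy.1.2 K v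
      obtain ⟨a', b', z, ht, -, -, hz⟩ := hgen a b x u htr y.1 hmem (hjet.symm ▸ hy.2)
      exact ⟨_, (hz _ ht).1, (hz _ ht).2.trans (congrArg Prod.fst hjet)⟩)
  exact ⟨q, hq, hqU.1.1, hreg⟩

theorem exists_isStaticFeedbackLinearization (h : S.IsExplicitSolution ν W ψ)
    (hd : Module.finrank ℝ (ControlSpace n m) = Module.finrank ℝ ν.JetSpace) :
    ∃ W' ⊆ W, S.IsStaticFeedbackLinearization ν W' ψ := by
  have hn : ∑ a : ν.Label, ν.order a = n := by
    have := ν.finrank_jetSpace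
    rw [← hd, finrank_controlSpace, h.card_eq] at this
    omega
  have hopen : IsOpen (W ∩ fderiv ℝ ψ ⁻¹'
      range ((↑) : (ν.JetSpace ≃L[ℝ] ControlSpace n m) → ν.JetSpace →L[ℝ] ControlSpace n m)) :=
    (h.smooth.continuousOn_fderiv_of_isOpen h.isOpen (by simp)).isOpen_inter_preimage h.isOpen
      (ContinuousLinearEquiv.isOpen (𝕜 := ℝ))
  refine ⟨_, inter_subset_left, hopen, h.mapsTo.mono_left inter_subset_left, ?_, h.card_eq,
    isLocalDiffeomorphOn_of_fderiv_mem_range hopen (h.smooth.mono inter_subset_left)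
      fun q hq => hq.2, fun q hq => h.time q hq.1, fun q hq => h.exists_states hq.1, ?_⟩
  · refine fun p hp => mem_closure_iff.2 fun U hU hpU => ?_
    obtain ⟨q, hq, hqU, hreg⟩ := h.exists_fderiv_mem_range hd hU ⟨p, hpU, hp⟩
    exact ⟨ψ q, hqU, q, ⟨hq, hreg⟩, rfl⟩
  · rintro q ⟨hq, e, he⟩
    -- Pullback by an invertible map keeps dimension `n`, the most that `β^ν` can have.
    refine Submodule.eq_of_le_of_finrank_le (h.map_pfaffian_le hq)
      ((Signature.finrank_brunovsky_le q).trans ?_)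
    have hinj : Function.Injective
        (fderiv ℝ ψ q : ν.JetSpace →ₗ[ℝ] ControlSpace n m).dualMap := by
      rw [← he]
      exact LinearMap.dualMap_injective_of_surjective e.surjective
    rw [← (Submodule.equivMapOfInjective _ hinj _).finrank_eq, finrank_pfaffian, hn]

end IsExplicitSolution

/-! ### From linearizations to explicit solutions. -/

namespace IsStaticFeedbackLinearization

variable {S} {ν : Signature} {W : Set ν.JetSpace} {φ : ν.JetSpace → ControlSpace n m}

theorem nonempty (h : S.IsStaticFeedbackLinearization ν W φ) : W.Nonempty := by
  obtain ⟨p, hp⟩ := S.nonempty_dom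
  exact (closure_nonempty_iff.1 ⟨p, h.dense hp⟩).of_image

theorem fderiv_mem_range (h : S.IsStaticFeedbackLinearization ν W φ) {q : ν.JetSpace}
    (hq : q ∈ W) : fderiv ℝ φ q ∈
      range ((↑) : (ν.JetSpace ≃L[ℝ] ControlSpace n m) → ν.JetSpace →L[ℝ] ControlSpace n m) :=
  (h.localDiffeo ⟨q, hq⟩).fderiv_mem_range

theorem finrank_eq (h : S.IsStaticFeedbackLinearization ν W φ) :
    Module.finrank ℝ (ControlSpace n m) = Module.finrank ℝ ν.JetSpace := by
  obtain ⟨q, hq⟩ := h.nonempty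
  obtain ⟨e, -⟩ := h.fderiv_mem_range hq
  exact e.toLinearEquiv.finrank_eq.symm

theorem contDiffOn (h : S.IsStaticFeedbackLinearization ν W φ) : ContDiffOn ℝ ∞ φ W :=
  contMDiffOn_iff_contDiffOn.1 h.localDiffeo.contMDiffOn

theorem differentiableAt (h : S.IsStaticFeedbackLinearization ν W φ) {q : ν.JetSpace}
    (hq : q ∈ W) : DifferentiableAt ℝ φ q :=
  (h.contDiffOn.contDiffAt (h.isOpen.mem_nhds hq)).differentiableAt (by simp)

theorem isTrajectory (h : S.IsStaticFeedbackLinearization ν W φ) {a b : ℝ}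
    {z : ν.Label → ℝ → ℝ} (hz : ∀ c, ContDiffOn ℝ ∞ (z c) (Ioo a b))
    (hW : ∀ t ∈ Ioo a b, ν.jet z t ∈ W) :
    S.IsTrajectory a b (fun t => (φ (ν.jet z t)).2.1) (fun t => (φ (ν.jet z t)).2.2) := by
  have hsm : ContDiffOn ℝ ∞ (fun t => φ (ν.jet z t)) (Ioo a b) :=
    h.contDiffOn.comp (Signature.contDiffOn_jet isOpen_Ioo hz) hW
  refine ⟨contDiff_fst.comp_contDiffOn (contDiff_snd.comp_contDiffOn hsm),
    contDiff_snd.comp_contDiffOn (contDiff_snd.comp_contDiffOn hsm), fun t ht => ?_⟩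
  have htime : ∀ s ∈ Ioo a b, (φ (ν.jet z s)).1 = s := fun s hs => h.time _ (hW s hs)
  have hφ : ((t, (φ (ν.jet z t)).2.1, (φ (ν.jet z t)).2.2) : ControlSpace n m)
      = φ (ν.jet z t) := Prod.ext (htime t ht).symm rfl
  rw [hφ]
  refine ⟨h.mapsTo (hW t ht), ?_⟩
  have hjet := Signature.hasDerivAt_jet isOpen_Ioo hz ht
  have hder := (h.differentiableAt (hW t ht)).hasFDerivAt.comp_hasDerivAt t hjet
  set X := ν.prolong (ν.jet z t) fun a => iteratedDeriv (ν.order a + 1) (z a) t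
  have h1 : (fderiv ℝ φ (ν.jet z t) X).1 = 1 := hder.prod_fst.unique
    ((hasDerivAt_id t).congr_of_eventuallyEq
      (Filter.eventually_of_mem (isOpen_Ioo.mem_nhds ht) htime))
  refine hder.prod_snd.prod_fst.congr_deriv (Eq.symm ?_)
  funext i
  have hmem : (S.form (φ (ν.jet z t)) i).comp (fderiv ℝ φ (ν.jet z t)).toLinearMap
      ∈ ν.brunovsky (ν.jet z t) := by
    rw [← h.pullback _ (hW t ht)]
    exact ⟨_, Submodule.subset_span ⟨i, rfl⟩, rfl⟩
  have h0 : S.form (φ (ν.jet z t)) i (fderiv ℝ φ (ν.jet z t) X) = 0 :=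
    Module.Dual.apply_eq_zero_of_mem_span (v := X) (fun p => by
      rw [Signature.contactForm_apply, Signature.prolong_castSucc]
      exact (sub_eq_zero.2 (mul_one _).symm)) hmem
  rw [form_apply, h1, mul_one, sub_eq_zero] at h0
  exact h0.symm

/-- Trajectories that reach the image of the linearization are images of jets, locally. -/
theorem exists_jet (h : S.IsStaticFeedbackLinearization ν W φ) {a b : ℝ} {x : ℝ → Fin n → ℝ}
    {u : ℝ → Fin m → ℝ} (htr : S.IsTrajectory a b x u) {t₀ : ℝ} (ht₀ : t₀ ∈ Ioo a b)
    (himg : (t₀, x t₀, u t₀) ∈ φ '' W) :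
    ∃ (a' b' : ℝ) (z : ν.Label → ℝ → ℝ), t₀ ∈ Ioo a' b' ∧ Ioo a' b' ⊆ Ioo a b ∧
      (∀ c, ContDiffOn ℝ ∞ (z c) (Ioo a' b')) ∧
      ∀ t ∈ Ioo a' b', ν.jet z t ∈ W ∧ φ (ν.jet z t) = (t, x t, u t) := by
  obtain ⟨q, hq, hq0⟩ := himg
  obtain ⟨V, g, hV, hqV, hg, hgV⟩ := (h.localDiffeo ⟨q, hq⟩).exists_section h.isOpen hq
  let γ : ℝ → ControlSpace n m := fun t => (t, x t, u t)
  have hγ : ContDiffOn ℝ ∞ γ (Ioo a b) := contDiffOn_id.prodMk (htr.1.prodMk htr.2.1)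
  have hopen : IsOpen (Ioo a b ∩ γ ⁻¹' V) := hγ.continuousOn.isOpen_inter_preimage isOpen_Ioo hV
  have hmem : t₀ ∈ Ioo a b ∩ γ ⁻¹' V := ⟨ht₀, by rw [hq0] at hqV; exact hqV⟩
  obtain ⟨a', b', hab, hsub⟩ := mem_nhds_iff_exists_Ioo_subset.1 (hopen.mem_nhds hmem)
  have hc : ContDiffOn ℝ ∞ (fun t => g (γ t)) (Ioo a' b') :=
    hg.comp (hγ.mono fun t ht => (hsub ht).1) fun t ht => (hsub ht).2
  have hcW : ∀ t ∈ Ioo a' b', g (γ t) ∈ W ∧ φ (g (γ t)) = γ t := fun t ht => hgV _ (hsub ht).2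
  have hcd : ∀ t ∈ Ioo a' b', DifferentiableAt ℝ (fun t => g (γ t)) t := fun t ht =>
    (hc.contDiffAt (isOpen_Ioo.mem_nhds ht)).differentiableAt (by simp)
  have hjet : ∀ t ∈ Ioo a' b', ν.jet (fun a t => (g (γ t)).2 a 0) t = g (γ t) := by
    intro t ht
    refine Signature.jet_eq_of_hasDerivAt isOpen_Ioo hcd (fun t ht => ?_) (fun t ht a l => ?_) ht
    · rw [← h.time _ (hcW t ht).1, (hcW t ht).2]
    · have hu : DifferentiableAt ℝ u t :=
        (htr.2.1.contDiffAt (isOpen_Ioo.mem_nhds (hsub ht).1)).differentiableAt (by simp)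
      have hx := (htr.2.2 t (hsub ht).1).2
      have h1 : HasDerivAt γ (1, S.f (γ t), deriv u t) t :=
        (hasDerivAt_id t).prodMk (hx.prodMk hu.hasDerivAt)
      have h2 := ((h.differentiableAt (hcW t ht).1).hasFDerivAt.comp_hasDerivAt t
        (hcd t ht).hasDerivAt).congr_of_eventuallyEq (Filter.eventually_of_mem
          (isOpen_Ioo.mem_nhds ht) fun s hs => ((hcW s hs).2).symm)
      have hmem : ν.contactForm (g (γ t)) a l ∈ ν.brunovsky (g (γ t)) :=
        Submodule.subset_span ⟨⟨a, l⟩, rfl⟩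
      rw [← h.pullback _ (hcW t ht).1] at hmem
      obtain ⟨η, hη, hηeq⟩ := hmem
      -- The differential of `φ` returns the lifted velocity to that of the trajectory, on which `ω`
      -- vanishes.
      rw [← hηeq]
      show η (fderiv ℝ φ (g (γ t)) _) = 0
      rw [h2.unique h1]
      refine Module.Dual.apply_eq_zero_of_mem_span (fun i => ?_) hη
      rw [form_apply, (hcW t ht).2, mul_one, sub_self]
  refine ⟨a', b', fun a t => (g (γ t)).2 a 0, hab, fun t ht => (hsub ht).1, fun c => ?_,
    fun t ht => ?_⟩
  · exact contDiffOn_pi.1 (contDiffOn_pi.1 (contDiff_snd.comp_contDiffOn hc) c) 0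
  · rw [hjet t ht]
    exact hcW t ht

theorem isExplicitSolution (h : S.IsStaticFeedbackLinearization ν W φ) :
    S.IsExplicitSolution ν W φ where
  isOpen := h.isOpen
  smooth := h.contDiffOn
  mapsTo := h.mapsTo
  time := h.time
  card_eq := h.card_eq
  occurs a := by
    obtain ⟨q, hq⟩ := h.nonempty
    obtain ⟨e, he⟩ := h.fderiv_mem_range hq
    refine ⟨q, hq, fun h0 => ?_⟩
    rw [← he] at h0
    have h1 : ν.topVector a = 0 := (map_eq_zero_iff e e.injective).1 h0
    have h2 := congrFun (congrFun (congrArg Prod.snd h1) a) (Fin.last _)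
    simp [Signature.topVector] at h2
  isTrajectory _ _ _ hz hW := h.isTrajectory hz hW
  generic := by
    have hopen : IsOpen (φ '' W) := by
      refine isOpen_iff_mem_nhds.2 ?_
      rintro _ ⟨q, hq, rfl⟩
      obtain ⟨V, g, hV, hqV, -, hgV⟩ := (h.localDiffeo ⟨q, hq⟩).exists_section h.isOpen hq
      exact Filter.mem_of_superset (hV.mem_nhds hqV) fun y hy => ⟨g y, (hgV y hy).1, (hgV y hy).2⟩
    -- No input derivatives are needed (`K = 0`): a trajectory is generic once it meets the open
    -- dense image.
    refine ⟨0, (φ '' W) ×ˢ univ, hopen.prod isOpen_univ, ?_, fun a b x u htr t₀ ht₀ hG =>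
      h.exists_jet htr ht₀ hG.1⟩
    rw [closure_prod_eq]
    exact prod_mono h.dense subset_closure

end IsStaticFeedbackLinearization

end ControlSystem

theorem mainTheorem7 {n m : ℕ} (S : ControlSystem n m) :
    (∀ (ν : Signature) (W : Set ν.JetSpace) (ψ : ν.JetSpace → ControlSpace n m),
      S.IsExplicitSolution ν W ψ →
        ((∃ W' ⊆ W, S.IsStaticFeedbackLinearization ν W' ψ) ↔
          Module.finrank ℝ (ControlSpace n m) = Module.finrank ℝ ν.JetSpace)) ∧
    (S.IsSFL ↔
      ∃ (ν : Signature) (W : Set ν.JetSpace) (ψ : ν.JetSpace → ControlSpace n m),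
        S.IsExplicitSolution ν W ψ ∧
          Module.finrank ℝ (ControlSpace n m) = Module.finrank ℝ ν.JetSpace) := by
  have h1 : ∀ (ν : Signature) (W : Set ν.JetSpace) (ψ : ν.JetSpace → ControlSpace n m),
      S.IsExplicitSolution ν W ψ →
        ((∃ W' ⊆ W, S.IsStaticFeedbackLinearization ν W' ψ) ↔
          Module.finrank ℝ (ControlSpace n m) = Module.finrank ℝ ν.JetSpace) :=
    fun ν W ψ h => ⟨fun ⟨_, _, h'⟩ => h'.finrank_eq, h.exists_isStaticFeedbackLinearization⟩
  refine ⟨h1, ?_, ?_⟩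
  · rintro ⟨ν, W, φ, h⟩
    exact ⟨ν, W, φ, h.isExplicitSolution, h.finrank_eq⟩
  · rintro ⟨ν, W, ψ, h, hd⟩
    obtain ⟨W', -, h'⟩ := (h1 ν W ψ h).2 hd
    exact ⟨ν, W', ψ, h'⟩
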